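/- Let $k\ge 2$ and let $U_1,\dots,U_k$ be nonempty sets, each regarded as a uniform metric space with all pairwise distances equal to $1$. In the generalized $k$-server problem on $U_1,\dots,U_k$, a configuration is a tuple $q\in\prod_i U_i$ and so is a request $r$; $q$ satisfies $r$ if $q_i=r_i$ for some $i$. Starting from a given initial configuration $q^0$, requests $r^1,r^2,\dots$ arrive one at a time, and upon the arrival of $r^t$ one has to choose a configuration $q^t$ that satisfies $r^t$, at the cost $|\{i: q^t_i\ne q^{t-1}_i\}|$. For a finite request sequence $\sigma$, $\mathrm{OPT}(\sigma)$ is the minimum total cost of serving $\sigma$ from $q^0$ when $\sigma$ is known in advance. Theorem 2. There is an absolute constant $C>0$ such that, for all $k\ge2$, all $U_1,\dots,U_k$ and all $q^0$, there is a randomized online algorithm $\mathrm{ALG}$ that serves every request and satisfies, for every finite request sequence $\sigma$ fixed in advance (oblivious adversary), $$\mathbb E[\mathrm{ALG}(\sigma)]\le c_k\,\mathrm{OPT}(\sigma)+c_k,\qquad c_k=C\,k^3\log k .$$ Thus its competitive ratio is $O(k^3\log k)$. Moreover, this holds (with the same $C$) for the following algorithm. For $v\in\prod_i(U_i\cup\{*\})$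 let $S(v)$ be the space of all configurations $c$ with $c_i=v_i$ whenever $v_i\neq *$; its dimension is the number of free coordinates, i.e. of $i$ with $v_i=*$. The algorithm keeps a finite family $\mathcal F$ of such spaces (vectors $v$), empty at the start, and a chosen space $Q$ (none at the start). When a request $r$ arrives, every $S(v)\in\mathcal F$ that contains a configuration not satisfying $r$ is replaced by the spaces obtained from $v$ by setting one free coordinate $i$ to $r_i$ (it is removed if there is no free coordinate). If $\mathcal F$ is now empty, it is set to $\{S(r_1,*,\dots,*),\dots,S(*,\dots,*,r_k)\}$. If $Q$ is one of the spaces of maximal dimension in $\mathcal F$, the algorithm stays where it is; otherwise it draws a new $Q$ uniformly at random from the spaces of maximal dimension in $\mathcal F$ and moves to an arbitrary configuration in $Q$. -/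

import Mathlib

open scoped ENNReal

namespace GenKServer

universe u

/-- A configuration of the `k` servers: server `i` is at the point `q i` of the `i`-th uniform
metric space, whose set of points is `U i`. Requests are `k`-tuples of the same kind. -/
abbrev Config {k : ℕ} (U : Fin k → Type u) : Type u := ∀ i, U i

section Problem

variable {k : ℕ} {U : Fin k → Type u}

/-- The configuration `q` satisfies the request `r`: some server is at its requested point. -/
def Satisfies (q r : Config U) : Prop := ∃ i, q i = r i

open Classical in
/-- Total movement cost of visiting the listed configurations one after the other, starting from
`q₀`. All the metrics are uniform with unit distance, so a move from `q` to `q'` costs the Hamming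
distance of `q` and `q'`. -/
noncomputable def scheduleCost : Config U → List (Config U) → ℕ
  | _, [] => 0
  | q₀, q :: τ => hammingDist q₀ q + scheduleCost q τ

/-- The schedule `τ` serves the request sequence `σ`: the two have the same length, and the `t`-th
configuration satisfies the `t`-th request. -/
def Serves (τ σ : List (Config U)) : Prop := List.Forall₂ Satisfies τ σ

/-- The optimal offline cost of serving `σ` starting from `q₀`. -/
noncomputable def optCost (q₀ : Config U) (σ : List (Config U)) : ℕ :=
  sInf {c | ∃ τ, Serves τ σ ∧ scheduleCost q₀ τ = c}

/-- The infimum in `optCost` is over a nonempty set, so it is a minimum. -/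
theorem exists_optimal_schedule [NeZero k] (q₀ : Config U) (σ : List (Config U)) :
    ∃ τ, Serves τ σ ∧ scheduleCost q₀ τ = optCost q₀ σ :=
  Nat.sInf_mem (s := {c | ∃ τ, Serves τ σ ∧ scheduleCost q₀ τ = c})
    ⟨_, σ, List.forall₂_same.2 fun _ _ => ⟨0, rfl⟩, rfl⟩

/-- A randomized online algorithm with initial configuration `q₀`: it has an internal state
(arbitrary memory), which determines the positions of the servers; when a request arrives, the new
state is drawn at random, from a distribution that depends on the current state and on this
request only. -/
structure RandomizedAlgorithm (q₀ : Config U) where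
  State : Type u
  init : State
  config : State → Config U
  config_init : config init = q₀
  step : State → Config U → PMF State

namespace RandomizedAlgorithm

variable {q₀ : Config U}

/-- The distribution of the sequence of configurations that the algorithm goes through, if it
starts in state `s` and is given a fixed request sequence. -/
noncomputable def runFrom (A : RandomizedAlgorithm q₀) :
    A.State → List (Config U) → PMF (List (Config U))
  | _, [] => PMF.pure []
  | s, r :: σ => (A.step s r).bind fun s' =>
      (A.runFrom s' σ).map fun τ => A.config s' :: τ

/-- The distribution of the schedule that the algorithm produces on the request sequence `σ`. -/
noncomputable def run (A : RandomizedAlgorithm q₀) (σ : List (Config U)) :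
    PMF (List (Config U)) :=
  A.runFrom A.init σ

/-- Whatever the requests and the random choices are, every request is served. -/
def ServesRequests (A : RandomizedAlgorithm q₀) : Prop :=
  ∀ σ, ∀ τ ∈ (A.run σ).support, Serves τ σ

/-- The expected cost of the algorithm on the (fixed) request sequence `σ`. -/
noncomputable def expectedCost (A : RandomizedAlgorithm q₀) (σ : List (Config U)) : ℝ≥0∞ :=
  ∑' τ, A.run σ τ * (scheduleCost q₀ τ : ℝ≥0∞)

/-- The algorithm is `ρ`-competitive against oblivious adversaries, with additive constant `α`. -/
def IsCompetitive (A : RandomizedAlgorithm q₀) (ρ α : ℝ) : Prop :=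
  ∀ σ : List (Config U),
    A.expectedCost σ ≤ ENNReal.ofReal ρ * (optCost q₀ σ : ℝ≥0∞) + ENNReal.ofReal α

end RandomizedAlgorithm

end Problem

section SubspaceAlgorithm

variable {k : ℕ}

/-- A coordinate subspace is given by a vector `v`; the `i`-th coordinate is free if `v i = none`,
and it is fixed to the point `a` if `v i = some a`. -/
abbrev Space (U : Fin k → Type u) : Type u := ∀ i, Option (U i)

variable {U : Fin k → Type u}

namespace Space

/-- The set of configurations in the space. -/
def points (v : Space U) : Set (Config U) := {c | ∀ i a, v i = some a → c i = a}

/-- The dimension: the number of free coordinates. -/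
def dim (v : Space U) : ℕ := (Finset.univ.filter fun i => (v i).isNone).card

open Classical in
/-- What replaces the space `v` when the request `r` arrives: `v` stays if all its configurations
satisfy `r`; otherwise it is replaced by the spaces that arise by fixing one of its free
coordinates to the requested point (by nothing, if there is no free coordinate). -/
noncomputable def refine (v : Space U) (r : Config U) : Finset (Space U) :=
  if ∃ c ∈ v.points, ¬ Satisfies c r then
    (Finset.univ.filter fun i => (v i).isNone).image fun i => Function.update v i (some (r i))
  else {v}

end Space

open Classical in
/-- The spaces with one coordinate fixed to the requested point and all the others free. -/
noncomputable def startFamily (r : Config U) : Finset (Space U) :=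
  Finset.univ.image fun i => Function.update (fun _ => none) i (some (r i))

open Classical in
/-- The update of the family of feasible spaces when the request `r` arrives. A new phase starts if
no space would be left. -/
noncomputable def nextFamily (F : Finset (Space U)) (r : Config U) : Finset (Space U) :=
  if F.biUnion (fun v => v.refine r) = ∅ then startFamily r else F.biUnion (fun v => v.refine r)

/-- The spaces of maximal dimension in the family. -/
def maxSpaces (F : Finset (Space U)) : Finset (Space U) :=
  F.filter fun v => v.dim = F.sup Space.dim

theorem nextFamily_nonempty [NeZero k] (F : Finset (Space U)) (r : Config U) :
    (nextFamily F r).Nonempty := by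
  classical
  unfold nextFamily
  split_ifs with h
  · exact Finset.univ_nonempty.image _
  · exact Finset.nonempty_iff_ne_empty.2 h

theorem maxSpaces_nonempty {F : Finset (Space U)} (hF : F.Nonempty) : (maxSpaces F).Nonempty := by
  obtain ⟨v, hv, h⟩ := Finset.exists_mem_eq_sup F hF Space.dim
  exact ⟨v, Finset.mem_filter.2 ⟨hv, h.symm⟩⟩

variable (U) in
/-- The memory of the subspace algorithm: the current family of feasible spaces, the space it has
chosen (none before the first request), and the current configuration. -/
structure SubspaceState where
  family : Finset (Space U)
  space : Option (Space U)
  config : Config U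

variable (U) in
/-- A rule for the choice of a point in the new space, which the algorithm is free to make. -/
structure PointRule where
  pick : SubspaceState U → Config U → Space U → Config U
  pick_mem : ∀ s r v, pick s r v ∈ v.points

/-- Point rules exist: for example, move the servers of the fixed coordinates only. -/
instance : Nonempty (PointRule U) :=
  ⟨⟨fun s _ v i => (v i).getD (s.config i), fun s r v i a h => by simp [h]⟩⟩

open Classical in
/-- One step: update the family; stay if the current space is still one of maximal dimension in the
family; otherwise choose a space of maximal dimension uniformly at random, and move to the point of
it that the rule picks. -/
noncomputable def subspaceStep [NeZero k] (P : PointRule U) (s : SubspaceState U)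
    (r : Config U) : PMF (SubspaceState U) :=
  if ∃ Q ∈ maxSpaces (nextFamily s.family r), s.space = some Q then
    PMF.pure ⟨nextFamily s.family r, s.space, s.config⟩
  else
    (PMF.uniformOfFinset (maxSpaces (nextFamily s.family r))
      (maxSpaces_nonempty (nextFamily_nonempty s.family r))).map
        fun Q => ⟨nextFamily s.family r, some Q, P.pick s r Q⟩

/-- The randomized subspace algorithm. It starts with the empty family, so that the first request
starts a phase. -/
noncomputable def subspaceAlgorithm [NeZero k] (q₀ : Config U) (P : PointRule U) :
    RandomizedAlgorithm q₀ where
  State := SubspaceState U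
  init := ⟨∅, none, q₀⟩
  config := SubspaceState.config
  config_init := rfl
  step := subspaceStep P

end SubspaceAlgorithm

end GenKServer

/-! During a phase the family covers every configuration that satisfies all requests of the phase so
far. When it dies out, no fixed configuration can have served them all, so any schedule has moved;
hence there are at most OPT + 1 phases (`phases_le_optCost`).

Refining a space of dimension d creates at most d spaces of dimension d - 1. Counting each space
with multiplicity d! thus gives a weight that never exceeds k!, so at most k! spaces are maximal.

Since requests are oblivious, the chosen space may be averaged over a uniform draw: given survival
it is uniform on the survivors, and otherwise it is redrawn uniformly. While the maximal dimension
stays fixed, shrinking from m to m' maximal spaces costs 1 - m'/m ≤ log m - log m' expected moves,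
so these telescope to log k!; each drop of dimension costs one more move. `meanMoves_le` turns this
into a potential argument: at most (k + 1)(1 + log k!) expected moves per phase. Each move costs at
most k, giving O(k³ log k). -/

namespace GenKServer

universe w

/-! ### Expectations as sums over a PMF -/

section Expectation

variable {α β : Type*}

theorem tsum_bind_mul (p : PMF α) (f : α → PMF β) (g : β → ℝ≥0∞) :
    ∑' b, p.bind f b * g b = ∑' a, p a * ∑' b, f a b * g b := by
  simp only [PMF.bind_apply, ← ENNReal.tsum_mul_right, ← ENNReal.tsum_mul_left]
  rw [ENNReal.tsum_comm]
  simp only [mul_assoc]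

theorem tsum_pure_mul (a : α) (g : α → ℝ≥0∞) : ∑' b, PMF.pure a b * g b = g a := by
  classical
  rw [tsum_eq_single a]
  · simp
  · intro b hb
    simp [PMF.pure_apply, hb]

theorem tsum_map_mul (p : PMF α) (f : α → β) (g : β → ℝ≥0∞) :
    ∑' b, p.map f b * g b = ∑' a, p a * g (f a) := by
  rw [← PMF.bind_pure_comp, tsum_bind_mul]
  simp only [Function.comp_apply, tsum_pure_mul]

theorem tsum_uniformOfFinset_mul (s : Finset α) (hs : s.Nonempty) (g : α → ℝ≥0∞) :
    ∑' a, PMF.uniformOfFinset s hs a * g a = ∑ a ∈ s, (s.card : ℝ≥0∞)⁻¹ * g a := by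
  rw [tsum_eq_sum (s := s)]
  · exact Finset.sum_congr rfl fun a ha => by rw [PMF.uniformOfFinset_apply_of_mem hs ha]
  · intro a ha
    rw [PMF.uniformOfFinset_apply_of_notMem hs ha, zero_mul]

end Expectation

variable {k : ℕ} {U : Fin k → Type w}

namespace RandomizedAlgorithm

variable {q₀ : Config U}

/-- The expected cost of serving the requests from the state `s` on. -/
noncomputable def costFrom (A : RandomizedAlgorithm q₀) (s : A.State) (σ : List (Config U)) :
    ℝ≥0∞ :=
  ∑' τ, A.runFrom s σ τ * (scheduleCost (A.config s) τ : ℝ≥0∞)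

theorem costFrom_nil (A : RandomizedAlgorithm q₀) (s : A.State) : A.costFrom s [] = 0 := by
  rw [costFrom, runFrom, tsum_pure_mul]
  simp [scheduleCost]

open Classical in
theorem costFrom_cons (A : RandomizedAlgorithm q₀) (s : A.State) (r : Config U)
    (σ : List (Config U)) :
    A.costFrom s (r :: σ) = ∑' s', A.step s r s' *
      ((hammingDist (A.config s) (A.config s') : ℝ≥0∞) + A.costFrom s' σ) := by
  rw [costFrom, runFrom, tsum_bind_mul]
  refine tsum_congr fun s' => ?_
  rw [tsum_map_mul]
  simp only [scheduleCost, Nat.cast_add, mul_add, ENNReal.tsum_add, ENNReal.tsum_mul_right,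
    PMF.tsum_coe, one_mul, costFrom]

theorem servesRequests_of_invariant {A : RandomizedAlgorithm q₀} {I : A.State → Prop}
    (hinit : I A.init)
    (hstep : ∀ s r, ∀ s', I s → s' ∈ (A.step s r).support → I s' ∧ Satisfies (A.config s') r) :
    A.ServesRequests := by
  intro σ
  change ∀ τ ∈ (A.runFrom A.init σ).support, Serves τ σ
  generalize A.init = s at hinit
  induction σ generalizing s with
  | nil =>
    intro τ hτ
    rw [runFrom, PMF.support_pure, Set.mem_singleton_iff] at hτ
    subst hτ
    exact List.Forall₂.nil
  | cons r σ ih =>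
    intro τ hτ
    rw [runFrom, PMF.mem_support_bind_iff] at hτ
    obtain ⟨s', hs', hτ⟩ := hτ
    obtain ⟨τ', hτ', rfl⟩ := (PMF.mem_support_map_iff _ _ _).1 hτ
    obtain ⟨h1, h2⟩ := hstep s r s' hinit hs'
    exact List.Forall₂.cons h2 (ih s' h1 τ' hτ')

theorem expectedCost_eq (A : RandomizedAlgorithm q₀) (σ : List (Config U)) :
    A.expectedCost σ = A.costFrom A.init σ := by
  rw [expectedCost, costFrom, run, A.config_init]

end RandomizedAlgorithm

/-! ### Refining one space -/

namespace Space

theorem satisfies_of_mem_refine {v w : Space U} {r c : Config U} (hw : w ∈ v.refine r)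
    (hc : c ∈ w.points) : Satisfies c r := by
  classical
  unfold refine at hw
  split_ifs at hw with h
  · obtain ⟨i, -, rfl⟩ := Finset.mem_image.1 hw
    exact ⟨i, hc i _ (by simp)⟩
  · obtain rfl := Finset.mem_singleton.1 hw
    by_contra hs
    exact h ⟨c, hc, hs⟩

theorem exists_mem_refine {v : Space U} {r c : Config U} (hc : c ∈ v.points)
    (hs : Satisfies c r) : ∃ w ∈ v.refine r, c ∈ w.points := by
  classical
  unfold refine
  split_ifs with h
  · obtain ⟨c', hc', hn⟩ := h
    -- Some point of `v` violates `r`, so no fixed coordinate of `v` agrees with `r`; hence `c`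
    -- meets `r` in a free one.
    obtain ⟨i, hi⟩ : ∃ i, v i = none ∧ c i = r i := by
      obtain ⟨i, hi⟩ := hs
      refine ⟨i, ?_, hi⟩
      rcases hv : v i with _ | a
      · rfl
      · exact absurd ⟨i, by rw [hc' i a hv, ← hc i a hv, hi]⟩ hn
    refine ⟨_, Finset.mem_image.2 ⟨i, by simp [hi.1], rfl⟩, fun j a hj => ?_⟩
    by_cases hji : j = i
    · subst hji
      simp only [Function.update_self, Option.some.injEq] at hj
      rw [hi.2, hj]
    · rw [Function.update_of_ne hji] at hj
      exact hc j a hj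
  · exact ⟨v, Finset.mem_singleton_self v, hc⟩

open Classical in
theorem dim_update {v : Space U} {i : Fin k} (hi : (v i).isNone) (a : U i) :
    dim (Function.update v i (some a)) + 1 = v.dim := by
  unfold dim
  rw [← Finset.card_erase_add_one (s := Finset.univ.filter fun i => (v i).isNone) (a := i)
    (by simpa using hi)]
  congr 2
  ext j
  by_cases hj : j = i
  · subst hj; simp
  · simp [hj]

theorem dim_le (v : Space U) : v.dim ≤ k := by
  simpa [dim] using Finset.card_filter_le (Finset.univ : Finset (Fin k)) fun i => (v i).isNone

theorem eq_or_dim_lt_of_mem_refine {v w : Space U} {r : Config U} (hw : w ∈ v.refine r) :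
    w = v ∨ w.dim < v.dim := by
  classical
  unfold refine at hw
  split_ifs at hw with h
  · obtain ⟨i, hi, rfl⟩ := Finset.mem_image.1 hw
    have := dim_update (by simpa using hi) (r i)
    exact Or.inr (by omega)
  · exact Or.inl (Finset.mem_singleton.1 hw)

open Classical in
-- There are at most d new spaces, of weight (d - 1)! each, and d · (d - 1)! = d!.
theorem sum_image_update_le (v : Space U) (r : Config U) :
    ∑ w ∈ (Finset.univ.filter fun i => (v i).isNone).image
      (fun i => Function.update v i (some (r i))), (dim w).factorial
      ≤ v.dim.factorial := by
  refine (Finset.sum_image_le_of_nonneg (fun _ _ => Nat.zero_le _)).trans ?_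
  have h : ∀ i ∈ Finset.univ.filter fun i => (v i).isNone,
      (dim (Function.update v i (some (r i)))).factorial = (v.dim - 1).factorial := by
    intro i hi
    have := dim_update (by simpa using hi) (r i)
    congr 1
    omega
  rw [Finset.sum_congr rfl h, Finset.sum_const, smul_eq_mul]
  change v.dim * _ ≤ _
  rcases Nat.eq_zero_or_pos v.dim with h0 | h0
  · simp [h0]
  · exact (Nat.mul_factorial_pred h0.ne').le

theorem sum_refine_le (v : Space U) (r : Config U) :
    ∑ w ∈ v.refine r, w.dim.factorial ≤ v.dim.factorial := by
  classical
  unfold refine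
  split_ifs with h
  · exact v.sum_image_update_le r
  · simp

end Space

/-! ### Coverage, weight and maximal spaces of the family -/

/-- The configurations that lie in one of the spaces of the family. -/
def Covers (F : Finset (Space U)) (c : Config U) : Prop := ∃ v ∈ F, c ∈ v.points

open Classical in
theorem covers_biUnion {F : Finset (Space U)} {r c : Config U} (hc : Covers F c)
    (hs : Satisfies c r) : Covers (F.biUnion fun v => v.refine r) c := by
  obtain ⟨v, hv, hcv⟩ := hc
  obtain ⟨w, hw, hcw⟩ := Space.exists_mem_refine hcv hs
  exact ⟨w, Finset.mem_biUnion.2 ⟨v, hv, hw⟩, hcw⟩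

theorem covers_startFamily {r c : Config U} (hs : Satisfies c r) : Covers (startFamily r) c := by
  classical
  obtain ⟨i, hi⟩ := hs
  refine ⟨_, Finset.mem_image_of_mem _ (Finset.mem_univ i), fun j a hj => ?_⟩
  by_cases hji : j = i
  · subst hji
    simp only [Function.update_self, Option.some.injEq] at hj
    rw [hi, hj]
  · simp [Function.update_of_ne hji] at hj

theorem satisfies_of_mem_startFamily {r c : Config U} {v : Space U} (hv : v ∈ startFamily r)
    (hc : c ∈ v.points) : Satisfies c r := by
  classical
  obtain ⟨i, -, rfl⟩ := Finset.mem_image.1 hv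
  exact ⟨i, hc i _ (by simp)⟩

theorem satisfies_of_mem_nextFamily {F : Finset (Space U)} {r c : Config U} {v : Space U}
    (hv : v ∈ nextFamily F r) (hc : c ∈ v.points) : Satisfies c r := by
  classical
  unfold nextFamily at hv
  split_ifs at hv with h
  · exact satisfies_of_mem_startFamily hv hc
  · obtain ⟨w, -, hw⟩ := Finset.mem_biUnion.1 hv
    exact Space.satisfies_of_mem_refine hw hc

/-- The number of spaces in the family, counted with multiplicity `dim!`. -/
def weight (F : Finset (Space U)) : ℕ := ∑ v ∈ F, v.dim.factorial

theorem weight_startFamily_le (r : Config U) : weight (startFamily r) ≤ k.factorial := by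
  classical
  simpa [weight, startFamily, Space.dim] using
    Space.sum_image_update_le (fun _ => none : Space U) r

theorem weight_nextFamily_le {F : Finset (Space U)} (r : Config U)
    (hF : weight F ≤ k.factorial) : weight (nextFamily F r) ≤ k.factorial := by
  classical
  unfold nextFamily
  split_ifs with h
  · exact weight_startFamily_le r
  · refine le_trans ?_ hF
    unfold weight
    -- Different spaces may refine to the same one; passing to the disjoint union only increases the
    -- sum.
    rw [show F.biUnion (fun v => v.refine r) =
      (F.sigma fun v => v.refine r).image Sigma.snd by ext; simp]
    refine (Finset.sum_image_le_of_nonneg fun _ _ => Nat.zero_le _).trans ?_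
    rw [Finset.sum_sigma]
    exact Finset.sum_le_sum fun v _ => v.sum_refine_le r

theorem card_maxSpaces_le (F : Finset (Space U)) : (maxSpaces F).card ≤ weight F := by
  refine (Finset.card_filter_le _ _).trans ?_
  rw [Finset.card_eq_sum_ones]
  exact Finset.sum_le_sum fun v _ => Nat.factorial_pos _

theorem sup_dim_le (F : Finset (Space U)) : F.sup Space.dim ≤ k :=
  Finset.sup_le fun v _ => v.dim_le

open Classical in
/-- While the family is merely refined, the spaces of maximal dimension get fewer, or else the
maximal dimension drops. -/
theorem maxSpaces_subset_or_sup_lt (F : Finset (Space U)) (r : Config U) :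
    let F' := F.biUnion fun v => v.refine r
    (F'.sup Space.dim = F.sup Space.dim ∧ maxSpaces F' ⊆ maxSpaces F) ∨
      F'.sup Space.dim + 1 ≤ F.sup Space.dim := by
  intro F'
  have hle : F'.sup Space.dim ≤ F.sup Space.dim := by
    refine Finset.sup_le fun w hw => ?_
    obtain ⟨v, hv, hw⟩ := Finset.mem_biUnion.1 hw
    refine le_trans ?_ (Finset.le_sup (f := Space.dim) hv)
    rcases Space.eq_or_dim_lt_of_mem_refine hw with rfl | h
    exacts [le_rfl, h.le]
  rcases hle.lt_or_eq with hlt | heq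
  · exact Or.inr hlt
  · refine Or.inl ⟨heq, fun w hw => ?_⟩
    obtain ⟨hw, hd⟩ := Finset.mem_filter.1 hw
    obtain ⟨v, hv, hwv⟩ := Finset.mem_biUnion.1 hw
    have hvd := Finset.le_sup (f := Space.dim) hv
    rcases Space.eq_or_dim_lt_of_mem_refine hwv with rfl | h
    · exact Finset.mem_filter.2 ⟨hv, hd.trans heq⟩
    · omega

theorem disjoint_maxSpaces {F F' : Finset (Space U)}
    (h : F.sup Space.dim ≠ F'.sup Space.dim) : Disjoint (maxSpaces F) (maxSpaces F') := by
  refine Finset.disjoint_left.2 fun v hv hv' => h ?_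
  rw [← (Finset.mem_filter.1 hv).2, ← (Finset.mem_filter.1 hv').2]

open Classical in
-- All points of a starting space satisfy `r`, so if it were in the old family it would survive the
-- refinement. Hence a space chosen from the old maximal ones is always redrawn at a phase change.
theorem disjoint_maxSpaces_startFamily {F : Finset (Space U)} {r : Config U}
    (h : (F.biUnion fun v => v.refine r) = ∅) :
    Disjoint (maxSpaces F) (maxSpaces (startFamily r)) := by
  refine Finset.disjoint_left.2 fun v hv hv' => ?_
  have hF := (Finset.mem_filter.1 hv).1
  have hs := (Finset.mem_filter.1 hv').1
  have hr : v ∈ v.refine r := by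
    unfold Space.refine
    rw [if_neg]
    · exact Finset.mem_singleton_self v
    · rintro ⟨c, hc, hn⟩
      exact hn (satisfies_of_mem_startFamily hs hc)
  have : v ∈ F.biUnion fun v => v.refine r := Finset.mem_biUnion.2 ⟨v, hF, hr⟩
  simp [h] at this

/-! ### Phases and the offline optimum -/

open Classical in
/-- The number of phases that start while the requests are processed. -/
noncomputable def phases : Finset (Space U) → List (Config U) → ℕ
  | _, [] => 0
  | F, r :: σ => (if (F.biUnion fun v => v.refine r) = ∅ then 1 else 0) +
      phases (nextFamily F r) σ

open Classical in
-- The last term is a debt, due while the schedule's position is uncovered. A position that stays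
-- put remains covered until a phase starts, so a phase start uses up either the debt or a move; a
-- move also pays for any new debt.
theorem phases_le_scheduleCost {τ σ : List (Config U)} (h : Serves τ σ) :
    ∀ (F : Finset (Space U)) (q : Config U),
      phases F σ ≤ scheduleCost q τ + if Covers F q then 0 else 1 := by
  induction h with
  | nil => intro F q; simp [phases]
  | @cons q' r τ σ hs _ ih =>
    intro F q
    have ih := ih (nextFamily F r) q'
    have hstay : q = q' → Covers F q → Covers (F.biUnion fun v => v.refine r) q' := by
      rintro rfl hc
      exact covers_biUnion hc hs
    have hmove : q ≠ q' → 0 < hammingDist q q' := hammingDist_pos.2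
    simp only [phases, scheduleCost]
    by_cases hn : (F.biUnion fun v => v.refine r) = ∅
    · have hnext : nextFamily F r = startFamily r := if_pos hn
      rw [if_pos hn]
      rw [hnext, if_pos (covers_startFamily hs)] at ih
      rw [hnext]
      by_cases hq : q = q'
      · have hc : ¬ Covers F q := by
          intro hc
          obtain ⟨v, hv, -⟩ := hstay hq hc
          simp [hn] at hv
        rw [if_neg hc]
        omega
      · have := hmove hq
        omega
    · have hnext : nextFamily F r = F.biUnion fun v => v.refine r := if_neg hn
      rw [if_neg hn]
      rw [← hnext] at hstay
      by_cases hq : q = q'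
      · by_cases hc : Covers F q
        · rw [if_pos (hstay hq hc)] at ih
          omega
        · rw [if_neg hc]
          split_ifs at ih <;> omega
      · have := hmove hq
        split_ifs at ih <;> omega

theorem phases_le_optCost [NeZero k] (q₀ : Config U) (σ : List (Config U)) :
    phases ∅ σ ≤ optCost q₀ σ + 1 := by
  classical
  obtain ⟨τ, hτ, hc⟩ := exists_optimal_schedule q₀ σ
  rw [← hc]
  refine (phases_le_scheduleCost hτ ∅ q₀).trans ?_
  split_ifs <;> omega

/-! ### Expected number of moves -/

open Classical in
/-- The expected number of moves of the subspace algorithm on the requests, if it starts with the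
given family and chosen space. -/
noncomputable def expectedMoves : Finset (Space U) → Option (Space U) → List (Config U) → ℝ
  | _, _, [] => 0
  | F, o, r :: σ =>
    if ∃ Q ∈ maxSpaces (nextFamily F r), o = some Q then expectedMoves (nextFamily F r) o σ
    else 1 + ((maxSpaces (nextFamily F r)).card : ℝ)⁻¹ *
      ∑ Q ∈ maxSpaces (nextFamily F r), expectedMoves (nextFamily F r) (some Q) σ

theorem expectedMoves_nonneg (F : Finset (Space U)) (o : Option (Space U))
    (σ : List (Config U)) : 0 ≤ expectedMoves F o σ := by
  induction σ generalizing F o with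
  | nil => exact le_rfl
  | cons r σ ih =>
    unfold expectedMoves
    split_ifs
    · exact ih _ _
    · have := Finset.sum_nonneg fun Q (_ : Q ∈ maxSpaces (nextFamily F r)) =>
        ih (nextFamily F r) (some Q)
      positivity

/-- The mean of `expectedMoves` over a uniformly random space of maximal dimension. -/
noncomputable def meanMoves (F : Finset (Space U)) (σ : List (Config U)) : ℝ :=
  ((maxSpaces F).card : ℝ)⁻¹ * ∑ Q ∈ maxSpaces F, expectedMoves F (some Q) σ

theorem expectedMoves_of_mem {F : Finset (Space U)} {Q : Space U} {r : Config U}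
    (hQ : Q ∈ maxSpaces (nextFamily F r)) (σ : List (Config U)) :
    expectedMoves F (some Q) (r :: σ) = expectedMoves (nextFamily F r) (some Q) σ := by
  rw [expectedMoves, if_pos ⟨Q, hQ, rfl⟩]

theorem expectedMoves_of_notMem {F : Finset (Space U)} {Q : Space U} {r : Config U}
    (hQ : Q ∉ maxSpaces (nextFamily F r)) (σ : List (Config U)) :
    expectedMoves F (some Q) (r :: σ) = 1 + meanMoves (nextFamily F r) σ := by
  rw [expectedMoves, if_neg, meanMoves]
  rintro ⟨Q', hQ', h⟩
  exact hQ (Option.some.inj h ▸ hQ')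

theorem meanMoves_cons_of_disjoint {F : Finset (Space U)} (hF : (maxSpaces F).Nonempty)
    {r : Config U} (h : Disjoint (maxSpaces F) (maxSpaces (nextFamily F r)))
    (σ : List (Config U)) :
    meanMoves F (r :: σ) = 1 + meanMoves (nextFamily F r) σ := by
  have hm : ((maxSpaces F).card : ℝ) ≠ 0 := by exact_mod_cast hF.card_pos.ne'
  rw [meanMoves, Finset.sum_congr rfl fun Q hQ =>
    expectedMoves_of_notMem (Finset.disjoint_left.1 h hQ) σ, Finset.sum_const, nsmul_eq_mul]
  field_simp

/-- Survivors contribute their own future, lost spaces one move and a fresh uniform draw; both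
average to the same future mean. -/
theorem meanMoves_cons_of_subset {F : Finset (Space U)} {r : Config U}
    (hF : (maxSpaces (nextFamily F r)).Nonempty)
    (h : maxSpaces (nextFamily F r) ⊆ maxSpaces F) (σ : List (Config U)) :
    meanMoves F (r :: σ) = 1 - ((maxSpaces (nextFamily F r)).card : ℝ) / (maxSpaces F).card +
      meanMoves (nextFamily F r) σ := by
  classical
  have hm' : ((maxSpaces (nextFamily F r)).card : ℝ) ≠ 0 := by exact_mod_cast hF.card_pos.ne'
  have hm : ((maxSpaces F).card : ℝ) ≠ 0 := by exact_mod_cast (hF.mono h).card_pos.ne'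
  have hsum : ∑ Q ∈ maxSpaces (nextFamily F r), expectedMoves (nextFamily F r) (some Q) σ =
      (maxSpaces (nextFamily F r)).card * meanMoves (nextFamily F r) σ := by
    rw [meanMoves]
    field_simp
  rw [meanMoves, ← Finset.sum_sdiff h, Finset.sum_congr rfl fun Q hQ =>
    expectedMoves_of_notMem (Finset.mem_sdiff.1 hQ).2 σ, Finset.sum_const, nsmul_eq_mul,
    Finset.sum_congr rfl fun Q hQ => expectedMoves_of_mem hQ σ, hsum,
    Finset.cast_card_sdiff h]
  field_simp
  ring

/-! ### The potential argument -/

/-- The potential of a family: an upper bound on the expected number of moves during the rest of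
the phase. -/
noncomputable def potential (F : Finset (Space U)) : ℝ :=
  Real.log (maxSpaces F).card + ((F.sup Space.dim : ℕ) : ℝ) * (1 + Real.log k.factorial)

theorem potential_nonneg (F : Finset (Space U)) : 0 ≤ potential F := by
  have h1 := Real.log_natCast_nonneg (maxSpaces F).card
  have h2 := Real.log_natCast_nonneg k.factorial
  unfold potential
  positivity

theorem log_card_maxSpaces_le {F : Finset (Space U)} (hF : weight F ≤ k.factorial) :
    Real.log (maxSpaces F).card ≤ Real.log k.factorial := by
  rcases Nat.eq_zero_or_pos (maxSpaces F).card with h | h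
  · simpa [h] using Real.log_natCast_nonneg k.factorial
  · exact Real.log_le_log (by exact_mod_cast h) (by exact_mod_cast (card_maxSpaces_le F).trans hF)

/-- The potential of every family, plus one, is at most this. -/
noncomputable def phaseBound (k : ℕ) : ℝ :=
  1 + Real.log k.factorial + k * (1 + Real.log k.factorial)

theorem one_add_potential_le {F : Finset (Space U)} (hF : weight F ≤ k.factorial) :
    1 + potential F ≤ phaseBound k := by
  have h1 := log_card_maxSpaces_le hF
  have h2 := Real.log_natCast_nonneg k.factorial
  have h3 : ((F.sup Space.dim : ℕ) : ℝ) ≤ k := by exact_mod_cast sup_dim_le F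
  have := mul_le_mul_of_nonneg_right h3 (by linarith : 0 ≤ 1 + Real.log k.factorial)
  unfold potential phaseBound
  linarith

theorem one_sub_div_le_log_sub_log {x y : ℝ} (hx : 0 < x) (hy : 0 < y) :
    1 - y / x ≤ Real.log x - Real.log y := by
  have := Real.log_le_sub_one_of_pos (div_pos hy hx)
  rw [Real.log_div hy.ne' hx.ne'] at this
  linarith

theorem meanMoves_le [NeZero k] (σ : List (Config U)) :
    ∀ F : Finset (Space U), F.Nonempty → weight F ≤ k.factorial →
      meanMoves F σ ≤ potential F + phaseBound k * phases F σ := by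
  classical
  induction σ with
  | nil =>
    intro F _ _
    simpa [meanMoves, expectedMoves, phases] using potential_nonneg F
  | cons r σ ih =>
    intro F hF hW
    have hW' := weight_nextFamily_le r hW
    have hF' := nextFamily_nonempty F r
    have hM := maxSpaces_nonempty hF
    have hM' := maxSpaces_nonempty hF'
    have ih := ih _ hF' hW'
    have hpos := potential_nonneg F
    simp only [phases]
    by_cases hn : (F.biUnion fun v => v.refine r) = ∅
    · have hnext : nextFamily F r = startFamily r := if_pos hn
      have hd : Disjoint (maxSpaces F) (maxSpaces (nextFamily F r)) := by
        rw [hnext]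
        exact disjoint_maxSpaces_startFamily hn
      rw [meanMoves_cons_of_disjoint hM hd, if_pos hn]
      -- The charge for the new phase covers the redraw and the whole new potential; the old
      -- potential is discarded.
      have := one_add_potential_le hW'
      push_cast
      linarith
    · have hnext : nextFamily F r = F.biUnion fun v => v.refine r := if_neg hn
      rw [if_neg hn, zero_add]
      have hor := maxSpaces_subset_or_sup_lt F r
      simp only [← hnext] at hor
      rcases hor with ⟨hd, hsub⟩ | hlt
      · rw [meanMoves_cons_of_subset hM' hsub]
        have hl := one_sub_div_le_log_sub_log
          (x := (maxSpaces F).card) (y := (maxSpaces (nextFamily F r)).card)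
          (by exact_mod_cast hM.card_pos) (by exact_mod_cast hM'.card_pos)
        unfold potential at ih ⊢
        rw [hd] at ih
        linarith
      · rw [meanMoves_cons_of_disjoint hM (disjoint_maxSpaces (by omega))]
        have h1 := log_card_maxSpaces_le hW'
        have h2 := Real.log_natCast_nonneg (maxSpaces F).card
        -- The drop in dimension releases 1 + log k!: one move, and a reset of the logarithmic term.
        have h3 : (((nextFamily F r).sup Space.dim : ℕ) : ℝ) + 1 ≤ (F.sup Space.dim : ℕ) := by
          exact_mod_cast hlt
        have h4 := mul_le_mul_of_nonneg_right h3
          (by linarith [Real.log_natCast_nonneg k.factorial] : 0 ≤ 1 + Real.log k.factorial)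
        unfold potential at ih ⊢
        linarith

theorem expectedMoves_empty_le [NeZero k] (σ : List (Config U)) :
    expectedMoves (∅ : Finset (Space U)) none σ ≤ phaseBound k * phases (∅ : Finset (Space U)) σ := by
  cases σ with
  | nil => simp [expectedMoves, phases]
  | cons r σ =>
    have hW : weight (∅ : Finset (Space U)) ≤ k.factorial := by simp [weight]
    have hW' := weight_nextFamily_le r hW
    have h := meanMoves_le σ _ (nextFamily_nonempty ∅ r) hW'
    have := one_add_potential_le hW'
    rw [expectedMoves, if_neg (by simp), phases, if_pos (by simp)]
    rw [meanMoves] at h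
    push_cast
    linarith

/-! ### Cost and correctness of the subspace algorithm -/

section SubspaceAlgorithm

variable [NeZero k] (q₀ : Config U) (P : PointRule U)

/-- Any move costs at most k, whatever point is picked, so the bound does not depend on the current
configuration. -/
theorem costFrom_subspaceAlgorithm_le (σ : List (Config U)) :
    ∀ s : SubspaceState U, (subspaceAlgorithm q₀ P).costFrom s σ ≤
      k * ENNReal.ofReal (expectedMoves s.family s.space σ) := by
  classical
  induction σ with
  | nil => exact fun s => (RandomizedAlgorithm.costFrom_nil _ _).trans_le zero_le
  | cons r σ ih =>
    intro s
    refine (RandomizedAlgorithm.costFrom_cons _ _ _ _).trans_le ?_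
    change ∑' s', subspaceStep P s r s' * ((hammingDist s.config s'.config : ℝ≥0∞) +
      (subspaceAlgorithm q₀ P).costFrom s' σ) ≤ _
    unfold subspaceStep expectedMoves
    split_ifs with h
    · rw [tsum_pure_mul, hammingDist_self, Nat.cast_zero, zero_add]
      exact ih _
    · set M := maxSpaces (nextFamily s.family r) with hMdef
      have hM : M.Nonempty := maxSpaces_nonempty (nextFamily_nonempty s.family r)
      have hm : (M.card : ℝ≥0∞) ≠ 0 := by exact_mod_cast hM.card_pos.ne'
      rw [tsum_map_mul, tsum_uniformOfFinset_mul]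
      have hnn : ∀ Q ∈ M, 0 ≤ expectedMoves (nextFamily s.family r) (some Q) σ :=
        fun Q _ => expectedMoves_nonneg _ _ _
      have hsum := Finset.sum_nonneg hnn
      have hinv : ENNReal.ofReal ((M.card : ℝ)⁻¹) = (M.card : ℝ≥0∞)⁻¹ := by
        rw [ENNReal.ofReal_inv_of_pos (by exact_mod_cast hM.card_pos), ENNReal.ofReal_natCast]
      rw [ENNReal.ofReal_add zero_le_one (by positivity), ENNReal.ofReal_one,
        ENNReal.ofReal_mul (by positivity), hinv, ENNReal.ofReal_sum_of_nonneg hnn]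
      calc ∑ Q ∈ M, (M.card : ℝ≥0∞)⁻¹ * ((hammingDist s.config (P.pick s r Q) : ℝ≥0∞) +
            (subspaceAlgorithm q₀ P).costFrom ⟨nextFamily s.family r, some Q, P.pick s r Q⟩ σ)
          ≤ ∑ Q ∈ M, (M.card : ℝ≥0∞)⁻¹ * (k + k * ENNReal.ofReal
              (expectedMoves (nextFamily s.family r) (some Q) σ)) := by
            gcongr with Q hQ
            · simpa using hammingDist_le_card_fintype (x := s.config) (y := P.pick s r Q)
            · exact ih _
        _ = _ := by
            rw [← Finset.mul_sum, Finset.sum_add_distrib, Finset.sum_const, nsmul_eq_mul,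
              ← Finset.mul_sum, mul_add, mul_add, ← mul_assoc,
              ENNReal.inv_mul_cancel hm (ENNReal.natCast_ne_top _), one_mul, mul_one,
              mul_left_comm]

theorem mem_points_of_mem_support_subspaceStep {s s' : SubspaceState U} {r : Config U}
    (hs : ∀ Q, s.space = some Q → s.config ∈ Q.points)
    (hs' : s' ∈ (subspaceStep P s r).support) :
    (∀ Q, s'.space = some Q → s'.config ∈ Q.points) ∧ Satisfies s'.config r := by
  classical
  unfold subspaceStep at hs'
  split_ifs at hs' with h
  · rw [PMF.support_pure, Set.mem_singleton_iff] at hs'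
    subst hs'
    obtain ⟨Q, hQ, hsQ⟩ := h
    exact ⟨hs, satisfies_of_mem_nextFamily (Finset.mem_filter.1 hQ).1 (hs Q hsQ)⟩
  · obtain ⟨Q, hQ, rfl⟩ := (PMF.mem_support_map_iff _ _ _).1 hs'
    rw [PMF.mem_support_uniformOfFinset_iff] at hQ
    refine ⟨fun Q' hQ' => ?_,
      satisfies_of_mem_nextFamily (Finset.mem_filter.1 hQ).1 (P.pick_mem s r Q)⟩
    obtain rfl := Option.some.inj hQ'
    exact P.pick_mem s r Q

theorem servesRequests_subspaceAlgorithm : (subspaceAlgorithm q₀ P).ServesRequests :=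
  RandomizedAlgorithm.servesRequests_of_invariant
    (I := fun s : SubspaceState U => ∀ Q, s.space = some Q → s.config ∈ Q.points)
    (fun _ h => nomatch h) fun _ _ _ hs hs' => mem_points_of_mem_support_subspaceStep P hs hs'

theorem phaseBound_nonneg (k : ℕ) : 0 ≤ phaseBound k := by
  have := Real.log_natCast_nonneg k.factorial
  unfold phaseBound
  positivity

theorem isCompetitive_subspaceAlgorithm :
    (subspaceAlgorithm q₀ P).IsCompetitive (k * phaseBound k) (k * phaseBound k) := by
  intro σ
  have hB := phaseBound_nonneg k
  have hmoves : expectedMoves (∅ : Finset (Space U)) none σ ≤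
      phaseBound k * ((optCost q₀ σ : ℝ) + 1) := by
    refine (expectedMoves_empty_le σ).trans (mul_le_mul_of_nonneg_left ?_ hB)
    exact_mod_cast phases_le_optCost q₀ σ
  rw [RandomizedAlgorithm.expectedCost_eq]
  refine (costFrom_subspaceAlgorithm_le q₀ P σ ⟨∅, none, q₀⟩).trans ?_
  rw [← ENNReal.ofReal_natCast, ← ENNReal.ofReal_natCast, ← ENNReal.ofReal_mul (by positivity),
    ← ENNReal.ofReal_mul (by positivity), ← ENNReal.ofReal_add (by positivity) (by positivity)]
  refine ENNReal.ofReal_le_ofReal ?_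
  have := mul_le_mul_of_nonneg_left hmoves (Nat.cast_nonneg (α := ℝ) k)
  linarith

end SubspaceAlgorithm

theorem RandomizedAlgorithm.IsCompetitive.mono {q₀ : Config U} {A : RandomizedAlgorithm q₀}
    {ρ ρ' : ℝ} (h : A.IsCompetitive ρ ρ) (hρ : ρ ≤ ρ') : A.IsCompetitive ρ' ρ' := by
  intro σ
  refine (h σ).trans ?_
  gcongr

theorem mul_phaseBound_le {k : ℕ} (hk : 2 ≤ k) :
    k * phaseBound k ≤ 3 * (k : ℝ) ^ 3 * Real.log k := by
  have hk' : (2 : ℝ) ≤ k := by exact_mod_cast hk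
  have hfac : Real.log k.factorial ≤ k * Real.log k := by
    rw [← Real.log_pow]
    exact Real.log_le_log (by exact_mod_cast k.factorial_pos) (by exact_mod_cast k.factorial_le_pow)
  have hlog : 1 ≤ 2 * Real.log k := by
    have := Real.log_le_log two_pos hk'
    linarith [Real.log_two_gt_d9]
  -- This uses k log k ≥ 2 log k ≥ 1. With k + 1 ≤ 3k/2 it gives the constant 3.
  have h1 : 1 + Real.log k.factorial ≤ 2 * (k * Real.log k) := by
    nlinarith
  have h2 : phaseBound k = (1 + k) * (1 + Real.log k.factorial) := by
    unfold phaseBound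
    ring
  have h3 : phaseBound k ≤ (3 / 2 * k) * (2 * (k * Real.log k)) := by
    rw [h2]
    exact mul_le_mul (by linarith) h1
      (by linarith [Real.log_natCast_nonneg k.factorial]) (by linarith)
  calc k * phaseBound k ≤ k * ((3 / 2 * k) * (2 * (k * Real.log k))) := by gcongr
    _ = 3 * ((k : ℝ) ^ 3 * Real.log k) := by ring
    _ ≤ 3 * (k : ℝ) ^ 3 * Real.log k := by
      have : 0 ≤ (k : ℝ) ^ 3 * Real.log k := by positivity
      linarith

end GenKServer

theorem theorem2 :
    ∃ C : ℝ, 0 < C ∧ ∀ (k : ℕ) [NeZero k], 2 ≤ k →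
      ∀ (U : Fin k → Type*) (q₀ : GenKServer.Config U),
        (∃ A : GenKServer.RandomizedAlgorithm q₀, A.ServesRequests ∧
          A.IsCompetitive (C * (k : ℝ) ^ 3 * Real.log k) (C * (k : ℝ) ^ 3 * Real.log k)) ∧
        ∀ P : GenKServer.PointRule U,
          (GenKServer.subspaceAlgorithm q₀ P).ServesRequests ∧
          (GenKServer.subspaceAlgorithm q₀ P).IsCompetitive
            (C * (k : ℝ) ^ 3 * Real.log k) (C * (k : ℝ) ^ 3 * Real.log k) := by
  refine ⟨3, by norm_num, fun k _ hk U q₀ => ?_⟩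
  have main : ∀ P : GenKServer.PointRule U,
      (GenKServer.subspaceAlgorithm q₀ P).ServesRequests ∧
      (GenKServer.subspaceAlgorithm q₀ P).IsCompetitive
        (3 * (k : ℝ) ^ 3 * Real.log k) (3 * (k : ℝ) ^ 3 * Real.log k) := fun P =>
    ⟨GenKServer.servesRequests_subspaceAlgorithm q₀ P,
      (GenKServer.isCompetitive_subspaceAlgorithm q₀ P).mono (GenKServer.mul_phaseBound_le hk)⟩
  exact ⟨⟨_, main (Classical.arbitrary _)⟩, main⟩
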